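/- Let $d\ge 1$, let $\varepsilon_1,\dots,\varepsilon_d>0$, let $\Omega=\Omega_1\times\cdots\times\Omega_d\subset\mathbb R^d$ with $\Omega_i=[a_i,b_i]$, $a_i<b_i$, and let $\mathcal H_K(\Omega)$ be the reproducing kernel Hilbert space on $\Omega$ of the anisotropic Gaussian kernel $$K(x,y)=\exp\Big(-\sum_{i=1}^d\varepsilon_i^2(x_i-y_i)^2\Big).$$ For $\varepsilon>0$ put $\varphi_\ell^{\varepsilon}(t)=\sqrt{2^\ell\varepsilon^{2\ell}/\ell!}\;t^\ell e^{-\varepsilon^2t^2}$, $\ell=0,1,2,\dots$. For $n_1,\dots,n_d\in\mathbb N$ let $\mathcal X_{i,n_i}^*=\{x_{i,1}^*,\dots,x_{i,n_i}^*\}$ be approximate Fekete points on $\Omega_i$, that is, a set that maximises, among all sets $\{t_1,\dots,t_{n_i}\}$ of $n_i$ distinct points of $\Omega_i$, the determinant of the matrix $\big(\widehat K_i(t_k,t_m)\big)_{k,m=1}^{n_i}$ of the truncated kernel $\widehat K_i(s,t)=\sum_{\ell=0}^{n_i-1}\varphi^{\varepsilon_i}_\ell(s)\varphi^{\varepsilon_i}_\ell(t)$.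 Let $\mathcal X_N^*=\mathcal X_{1,n_1}^*\times\cdots\times\mathcal X_{d,n_d}^*$, $N=n_1\cdots n_d$, and for $f\in\mathcal H_K(\Omega)$ let $s_f$ be the kernel interpolant of $f$ at $\mathcal X_N^*$, that is, the element of least norm among all $g\in\mathcal H_K(\Omega)$ that agree with $f$ on $\mathcal X_N^*$. Let $c_{\Omega_i}=\sup_{t\in\Omega_i}|t|$. If $n_i\ge 2\varepsilon_i^2c_{\Omega_i}^2$ for every $i=1,\dots,d$, then for every $f\in\mathcal H_K(\Omega)$ $$\sup_{x\in\Omega}|f(x)-s_f(x)|\le C_1\,\|f\|_{\mathcal H_K(\Omega)}\sum_{i=1}^d n_i^{3/4}\exp\Big(-n_i\big(\tfrac12\log n_i-\log C_{i,2}\big)\Big),$$ where $C_1=(128/\pi)^{1/4}$ and $C_{i,2}=\sqrt{2e}\,\varepsilon_i c_{\Omega_i}$. -/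

import Mathlib

/-- The `d`-dimensional anisotropic Gaussian kernel
`K(x, y) = exp (-∑ i, ε i ^ 2 * (x i - y i) ^ 2)`. -/
noncomputable def gaussianKernel {d : ℕ} (ε x y : Fin d → ℝ) : ℝ :=
  Real.exp (-∑ i, ε i ^ 2 * (x i - y i) ^ 2)

theorem gaussianKernel_posSemidef {d : ℕ} (ε : Fin d → ℝ) (S : Set (Fin d → ℝ)) :
    (Matrix.of fun x y : S => gaussianKernel ε x y).PosSemidef := by
  set e : S → ℝ := fun x => Real.exp (-∑ i, ε i ^ 2 * (x.1 i) ^ 2) with he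
  set B : Matrix S S ℝ := Matrix.of fun x y => 2 * ∑ i, ε i ^ 2 * (x.1 i * y.1 i) with hB
  have hBpos : B.PosSemidef := by
    refine ⟨by ext x y; simp [hB, mul_comm], fun w => ?_⟩
    have : (w.sum fun x a => w.sum fun y b => star a * B x y * b)
        = 2 * ∑ i, ε i ^ 2 * (∑ x ∈ w.support, w x * x.1 i) ^ 2 := by
      have hterm : ∀ i, (∑ x ∈ w.support, w x * x.1 i) ^ 2
          = ∑ x ∈ w.support, ∑ y ∈ w.support, (w x * x.1 i) * (w y * y.1 i) := fun i => by
        rw [sq, Finset.sum_mul_sum]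
      simp only [Finsupp.sum, hB, Matrix.of_apply, star_trivial, hterm, Finset.mul_sum,
        Finset.sum_mul]
      rw [Finset.sum_comm (s := Finset.univ)]
      refine Finset.sum_congr rfl fun x _ => ?_
      rw [Finset.sum_comm (s := Finset.univ)]
      exact Finset.sum_congr rfl fun y _ => Finset.sum_congr rfl fun i _ => by ring
    rw [this]
    positivity
  have hpow : ∀ k : ℕ, (Matrix.of fun x y => B x y ^ k : Matrix S S ℝ).PosSemidef := by
    intro k
    induction k with
    | zero =>
      refine ⟨by ext x y; simp, fun w => ?_⟩
      have : (w.sum fun x a => w.sum fun y b =>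
          star a * (Matrix.of fun x y => B x y ^ 0 : Matrix S S ℝ) x y * b)
          = (∑ x ∈ w.support, w x) ^ 2 := by
        simp [Finsupp.sum, sq, Finset.sum_mul_sum]
      rw [this]
      positivity
    | succ k ih => exact ih.hadamard hBpos
  have hK : ∀ x y : S, gaussianKernel ε x y = e x * Real.exp (B x y) * e y := by
    intro x y
    simp only [gaussianKernel, he, hB, Matrix.of_apply, ← Real.exp_add]
    congr 1
    simp only [Finset.mul_sum, ← Finset.sum_neg_distrib, ← Finset.sum_add_distrib]
    exact Finset.sum_congr rfl fun i _ => by ring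
  refine ⟨?_, fun w => ?_⟩
  · ext x y
    simp only [Matrix.conjTranspose_apply, Matrix.of_apply, star_trivial, gaussianKernel]
    congr 2
    exact Finset.sum_congr rfl fun i _ => by ring
  · have hsum : HasSum (fun k : ℕ => ∑ x ∈ w.support, ∑ y ∈ w.support,
        (w x * e x) * (B x y ^ k / (k.factorial : ℝ)) * (w y * e y))
        (∑ x ∈ w.support, ∑ y ∈ w.support, (w x * e x) * Real.exp (B x y) * (w y * e y)) := by
      refine hasSum_sum fun x _ => hasSum_sum fun y _ => ?_
      have h := NormedSpace.expSeries_div_hasSum_exp (𝔸 := ℝ) (B x y)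
      rw [← Real.exp_eq_exp_ℝ] at h
      exact (h.mul_left _).mul_right _
    have hgoal : (w.sum fun x a => w.sum fun y b =>
        star a * (Matrix.of fun x y : S => gaussianKernel ε x y) x y * b)
        = ∑ x ∈ w.support, ∑ y ∈ w.support, (w x * e x) * Real.exp (B x y) * (w y * e y) := by
      simp only [Finsupp.sum, Matrix.of_apply, star_trivial, hK]
      exact Finset.sum_congr rfl fun x _ => Finset.sum_congr rfl fun y _ => by ring
    rw [hgoal]
    refine hsum.nonneg fun k => ?_
    have hk := (hpow k).2 (w.mapRange (fun a => a) rfl)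
    have hk' := (hpow k).2 (Finsupp.onFinset w.support (fun x => w x * e x)
      (by intro x hx; simp only [Finsupp.mem_support_iff]; exact left_ne_zero_of_mul hx))
    have hle : (Finsupp.onFinset w.support (fun x => w x * e x)
        (by intro x hx; simp only [Finsupp.mem_support_iff]
            exact left_ne_zero_of_mul hx)).support ⊆ w.support := Finsupp.support_onFinset_subset
    rw [Finsupp.sum_of_support_subset _ hle _ (by simp)] at hk'
    have : (∑ x ∈ w.support, ∑ y ∈ w.support,
        (w x * e x) * (B x y ^ k / (k.factorial : ℝ)) * (w y * e y))
        = (k.factorial : ℝ)⁻¹ * ∑ x ∈ w.support, ∑ y ∈ w.support,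
          (w x * e x) * B x y ^ k * (w y * e y) := by
      simp only [Finset.mul_sum]
      exact Finset.sum_congr rfl fun x _ => Finset.sum_congr rfl fun y _ => by ring
    rw [this]
    refine mul_nonneg (by positivity) (hk'.trans_eq (Finset.sum_congr rfl fun x _ => ?_))
    rw [Finsupp.sum_of_support_subset _ hle _ (by simp)]
    simp

/-- The Gaussian kernel on `S`, written as an operator-valued matrix: its entry at `(x, y)` is
multiplication by `K(x, y)` on `ℝ`. -/
noncomputable def gaussianMatrix {d : ℕ} (ε : Fin d → ℝ) (S : Set (Fin d → ℝ)) :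
    Matrix S S (ℝ →L[ℝ] ℝ) :=
  Matrix.of fun x y => gaussianKernel ε x y • ContinuousLinearMap.id ℝ ℝ

instance gaussianMatrix_posSemidef {d : ℕ} (ε : Fin d → ℝ) (S : Set (Fin d → ℝ)) :
    Fact (gaussianMatrix ε S).PosSemidef := by
  have htfae := RKHS.posSemidef_tfae (K := gaussianMatrix ε S)
  refine ⟨(htfae.out 0 2).2 (And.intro ?_ fun w => ?_)⟩
  · ext x y
    have := (gaussianKernel_posSemidef ε S).1.apply x y
    simp only [Matrix.of_apply, star_trivial] at this
    have hid : star (ContinuousLinearMap.id ℝ ℝ) = ContinuousLinearMap.id ℝ ℝ :=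
      star_one (ℝ →L[ℝ] ℝ)
    simp [gaussianMatrix, this, hid]
  · refine ((gaussianKernel_posSemidef ε S).2 w).trans_eq ?_
    rw [Finsupp.sum_comm]
    simp [gaussianMatrix, Finsupp.sum]
    refine Finset.sum_congr rfl fun x _ => Finset.sum_congr rfl fun y _ => by ring

/-- The reproducing kernel Hilbert space `H_K(S)` of the Gaussian kernel on `S ⊆ ℝ^d`. -/
abbrev GaussianRKHS {d : ℕ} (ε : Fin d → ℝ) (S : Set (Fin d → ℝ)) : Type :=
  RKHS.OfKernel (gaussianMatrix ε S)

/-- `s` is a minimum-norm interpolant of `f` at the points of `X`. -/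
def IsMinNormInterpolant {H Ω : Type*} [NormedAddCommGroup H] [InnerProductSpace ℝ H]
    [RKHS ℝ H Ω ℝ] (X : Set Ω) (f s : H) : Prop :=
  (∀ x ∈ X, s x = f x) ∧ ∀ g : H, (∀ x ∈ X, g x = f x) → ‖s‖ ≤ ‖g‖

theorem existsUnique_isMinNormInterpolant {H Ω : Type*} [NormedAddCommGroup H]
    [InnerProductSpace ℝ H] [CompleteSpace H] [RKHS ℝ H Ω ℝ] (X : Set Ω) (f : H) :
    ∃! s : H, IsMinNormInterpolant X f s := by
  let C : Set H := {g | ∀ x ∈ X, g x = f x}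
  have hC : IsClosed C := by
    have : C = ⋂ x ∈ X, {g : H | g x = f x} := by ext; simp [C]
    rw [this]
    exact isClosed_biInter fun x _ => isClosed_eq (RKHS.continuous_eval x) continuous_const
  have hconv : Convex ℝ C := by
    intro g hg h hh a b _ _ hab x hx
    simp [hg x hx, hh x hx, ← add_mul, hab]
  have hne : C.Nonempty := ⟨f, fun _ _ => rfl⟩
  obtain ⟨s, hs, hmin⟩ := exists_norm_eq_iInf_of_complete_convex hne hC.isComplete hconv 0
  have hle : ∀ g ∈ C, ‖s‖ ≤ ‖g‖ := by
    intro g hg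
    have h1 : ‖(0 : H) - s‖ ≤ ‖(0 : H) - g‖ := by
      rw [hmin]
      exact ciInf_le ⟨0, by rintro _ ⟨w, rfl⟩; exact norm_nonneg _⟩ (⟨g, hg⟩ : C)
    simpa using h1
  refine ⟨s, ⟨hs, hle⟩, fun t ht => ?_⟩
  have heq : ‖t‖ = ‖s‖ := le_antisymm (ht.2 s hs) (hle t ht.1)
  have hmid : ‖s‖ ≤ ‖(1 / 2 : ℝ) • (s + t)‖ := by
    apply hle
    intro x hx
    have h1 := hs x hx
    have h2 := ht.1 x hx
    simp only [RKHS.coe_smul, RKHS.coe_add, Pi.smul_apply, Pi.add_apply, h1, h2, smul_eq_mul]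
    ring
  rw [norm_smul] at hmid
  have hp := parallelogram_law_with_norm ℝ s t
  have h2 : ‖s - t‖ = 0 := by
    norm_num at hmid
    nlinarith [norm_nonneg s, norm_nonneg (s + t), norm_nonneg (s - t)]
  exact (sub_eq_zero.1 (norm_eq_zero.1 h2)).symm

/-- The kernel interpolant `s_f` of `f` at the points of `X`: the element of least norm among all
elements of the reproducing kernel Hilbert space that agree with `f` on `X`. -/
noncomputable def kernelInterpolant {H Ω : Type*} [NormedAddCommGroup H]
    [InnerProductSpace ℝ H] [CompleteSpace H] [RKHS ℝ H Ω ℝ] (X : Set Ω) (f : H) : H :=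
  (existsUnique_isMinNormInterpolant X f).choose

/-- The basis functions `φ_ℓ(x) = √(2^ℓ ε^(2ℓ) / ℓ!) x^ℓ exp(-ε² x²)`, `ℓ = 0, 1, …`, of the
one-dimensional Gaussian kernel `exp(-ε² (x - y)²)`. -/
noncomputable def gaussianBasis (ε : ℝ) (l : ℕ) (x : ℝ) : ℝ :=
  Real.sqrt (2 ^ l * ε ^ (2 * l) / (l.factorial : ℝ)) * x ^ l * Real.exp (-(ε ^ 2 * x ^ 2))

/-- The one-dimensional Gaussian kernel truncated after `n` terms. -/
noncomputable def truncatedKernel (ε : ℝ) (n : ℕ) (x y : ℝ) : ℝ :=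
  ∑ l ∈ Finset.range n, gaussianBasis ε l x * gaussianBasis ε l y

/-- `p` enumerates `n` approximate Fekete points on `S ⊆ ℝ` for the one-dimensional Gaussian kernel
with scale parameter `ε`: among all `n`-tuples of distinct points of `S`, it maximises the
determinant of the kernel matrix of the truncated kernel. -/
def IsApproxFekete (ε : ℝ) (S : Set ℝ) {n : ℕ} (p : Fin n → ℝ) : Prop :=
  p ∈ {q : Fin n → ℝ | q.Injective ∧ ∀ k, q k ∈ S} ∧
  IsMaxOn (fun q : Fin n → ℝ => (Matrix.of fun k m => truncatedKernel ε n (q k) (q m)).det)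
    {q : Fin n → ℝ | q.Injective ∧ ∀ k, q k ∈ S} p

/-- The hyper-rectangle `[a 0, b 0] × ⋯ × [a (d-1), b (d-1)]`. -/
def hyperRectangle {d : ℕ} (a b : Fin d → ℝ) : Set (Fin d → ℝ) :=
  Set.univ.pi fun i => Set.Icc (a i) (b i)

/-- The points of `S` that lie in the tensor product of the one-dimensional point sets
`{p i 0, …, p i (n i - 1)}`. -/
def tensorPoints {d : ℕ} (S : Set (Fin d → ℝ)) {n : Fin d → ℕ} (p : ∀ i, Fin (n i) → ℝ) : Set S :=
  {x | x.1 ∈ Set.univ.pi fun i => Set.range (p i)}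

/-- `c_S = sup {|x| : x ∈ S}`. -/
noncomputable def absSup (S : Set ℝ) : ℝ :=
  sSup ((fun x => |x|) '' S)

/-! Since the interpolation error vanishes on the nodes, its value at `x` is at most `‖f‖` times the
distance from the kernel translate at `x` to any combination of translates at nodes
(`abs_sub_kernelInterpolant_le`). The kernel is a product, so products of one-dimensional best
weights give squared distance `1 - ∏ (1 - δ i) ≤ ∑ δ i`, where `δ i` is the squared distance in
direction `i` (`norm_kerFun_sub_tensor_sq`).

In one dimension the values `φ_ℓ(x)` form a unit feature vector in `ℓ²`. Fekete maximality bounds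
the Lagrange weights by one; these weights reproduce the first `n` features, so only `n + 1` tails
remain, each of squared norm at most `(2ε²c²)^n / n!` (`IsApproxFekete.exists_projection_weights`).
Stirling's formula makes this explicit. -/

/-! ### Feature expansion of the one-dimensional kernel -/

theorem gaussianBasis_mul_gaussianBasis (ε : ℝ) (l : ℕ) (x y : ℝ) :
    gaussianBasis ε l x * gaussianBasis ε l y =
      (2 * ε ^ 2 * (x * y)) ^ l / (l.factorial : ℝ) *
        Real.exp (-(ε ^ 2 * x ^ 2) - ε ^ 2 * y ^ 2) := by
  have h : (0 : ℝ) ≤ 2 ^ l * ε ^ (2 * l) / (l.factorial : ℝ) := by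
    rw [pow_mul]; positivity
  have hs := Real.mul_self_sqrt h
  simp only [gaussianBasis]
  rw [show -(ε ^ 2 * x ^ 2) - ε ^ 2 * y ^ 2 = -(ε ^ 2 * x ^ 2) + -(ε ^ 2 * y ^ 2) by ring,
    Real.exp_add]
  calc _ = (Real.sqrt (2 ^ l * ε ^ (2 * l) / (l.factorial : ℝ)) *
        Real.sqrt (2 ^ l * ε ^ (2 * l) / (l.factorial : ℝ))) * (x ^ l * y ^ l) *
        (Real.exp (-(ε ^ 2 * x ^ 2)) * Real.exp (-(ε ^ 2 * y ^ 2))) := by ring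
    _ = _ := by rw [hs, mul_pow, mul_pow, mul_pow, pow_mul]; ring

theorem hasSum_gaussianBasis_mul (ε x y : ℝ) :
    HasSum (fun l => gaussianBasis ε l x * gaussianBasis ε l y)
      (Real.exp (-(ε ^ 2 * (x - y) ^ 2))) := by
  have h := NormedSpace.expSeries_div_hasSum_exp (𝔸 := ℝ) (2 * ε ^ 2 * (x * y))
  rw [← Real.exp_eq_exp_ℝ] at h
  have h2 := h.mul_right (Real.exp (-(ε ^ 2 * x ^ 2) - ε ^ 2 * y ^ 2))
  rw [← Real.exp_add] at h2
  simp only [gaussianBasis_mul_gaussianBasis]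
  rwa [show -(ε ^ 2 * (x - y) ^ 2) = 2 * ε ^ 2 * (x * y) + (-(ε ^ 2 * x ^ 2) - ε ^ 2 * y ^ 2) by
    ring]

/-- The sequence of basis values `φ_ℓ(x)` with the first `n` entries replaced by zero, as an
element of `ℓ²`. -/
noncomputable def gaussianTail (ε : ℝ) (n : ℕ) (x : ℝ) : lp (fun _ : ℕ => ℝ) 2 :=
  ⟨fun l => if n ≤ l then gaussianBasis ε l x else 0, by
    refine memℓp_gen ?_
    refine Summable.of_nonneg_of_le (fun l => by positivity) (fun l => ?_)
      (hasSum_gaussianBasis_mul ε x x).summable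
    split_ifs
    · simp [← sq]
    · simpa using mul_self_nonneg _⟩

@[simp]
theorem gaussianTail_apply (ε : ℝ) (n : ℕ) (x : ℝ) (l : ℕ) :
    gaussianTail ε n x l = if n ≤ l then gaussianBasis ε l x else 0 := rfl

theorem inner_gaussianTail_zero (ε x y : ℝ) :
    inner ℝ (gaussianTail ε 0 x) (gaussianTail ε 0 y) = Real.exp (-(ε ^ 2 * (x - y) ^ 2)) := by
  refine (lp.hasSum_inner _ _).unique ?_
  simpa [mul_comm] using hasSum_gaussianBasis_mul ε x y

/-- From `l! n! ≤ (l + n)!`, the tail of the exponential series is at most `r ^ n / n!` times the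
whole series, whose sum `exp r` cancels the Gaussian factor `exp (-r)`. -/
theorem norm_gaussianTail_sq_le (ε : ℝ) (n : ℕ) (x : ℝ) :
    ‖gaussianTail ε n x‖ ^ 2 ≤ (2 * ε ^ 2 * x ^ 2) ^ n / (n.factorial : ℝ) := by
  set r := 2 * ε ^ 2 * x ^ 2 with hr
  have hr0 : 0 ≤ r := by positivity
  have h1 := lp.hasSum_inner (𝕜 := ℝ) (gaussianTail ε n x) (gaussianTail ε n x)
  rw [real_inner_self_eq_norm_sq] at h1
  rw [← hasSum_nat_add_iff' n] at h1
  have hz : ∑ i ∈ Finset.range n, inner ℝ (gaussianTail ε n x i) (gaussianTail ε n x i) = 0 := by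
    refine Finset.sum_eq_zero fun i hi => ?_
    simp [not_le.2 (Finset.mem_range.1 hi)]
  rw [hz, sub_zero] at h1
  have h := NormedSpace.expSeries_div_hasSum_exp (𝔸 := ℝ) r
  rw [← Real.exp_eq_exp_ℝ] at h
  have h2 := (h.mul_right (Real.exp (-r))).mul_left (r ^ n / (n.factorial : ℝ))
  rw [← Real.exp_add, add_neg_cancel, Real.exp_zero, mul_one] at h2
  refine hasSum_le (fun l => ?_) h1 h2
  have hterm : inner ℝ (gaussianTail ε n x (l + n)) (gaussianTail ε n x (l + n)) =
      r ^ (l + n) / ((l + n).factorial : ℝ) * Real.exp (-r) := by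
    have := gaussianBasis_mul_gaussianBasis ε (l + n) x x
    rw [show 2 * ε ^ 2 * (x * x) = r by rw [hr]; ring,
      show -(ε ^ 2 * x ^ 2) - ε ^ 2 * x ^ 2 = -r by rw [hr]; ring] at this
    simpa [← sq] using this
  rw [hterm, ← mul_assoc]
  refine mul_le_mul_of_nonneg_right ?_ (Real.exp_pos _).le
  rw [div_mul_div_comm, ← pow_add, add_comm n l]
  refine div_le_div_of_nonneg_left (by positivity) (by positivity) ?_
  have := Nat.le_of_dvd (Nat.factorial_pos _) (Nat.factorial_mul_factorial_dvd_factorial_add l n)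
  rw [mul_comm]
  exact_mod_cast this

/-! ### Lagrange weights at approximate Fekete points -/

/-- The matrix `(φ_l(q_k))_{k,l}` of the first `n` basis functions at `n` points. -/
noncomputable def gaussianCollocation (ε : ℝ) {n : ℕ} (q : Fin n → ℝ) :
    Matrix (Fin n) (Fin n) ℝ :=
  Matrix.of fun k l => gaussianBasis ε l (q k)

/-- The kernel matrix factors as `V * Vᵀ`, so Fekete points maximise `|det V|`. -/
theorem det_truncatedKernel (ε : ℝ) {n : ℕ} (q : Fin n → ℝ) :
    (Matrix.of fun k m => truncatedKernel ε n (q k) (q m)).det =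
      (gaussianCollocation ε q).det ^ 2 := by
  have : (Matrix.of fun k m => truncatedKernel ε n (q k) (q m)) =
      gaussianCollocation ε q * (gaussianCollocation ε q).transpose := by
    ext k m
    simp [Matrix.mul_apply, gaussianCollocation, truncatedKernel, Finset.sum_range]
  rw [this, Matrix.det_mul, Matrix.det_transpose, sq]

theorem det_gaussianCollocation_ne_zero {ε : ℝ} (hε : 0 < ε) {n : ℕ} {q : Fin n → ℝ}
    (hq : q.Injective) : (gaussianCollocation ε q).det ≠ 0 := by
  have : gaussianCollocation ε q =
      Matrix.diagonal (fun k => Real.exp (-(ε ^ 2 * q k ^ 2))) * Matrix.vandermonde q *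
        Matrix.diagonal (fun l : Fin n =>
          Real.sqrt (2 ^ (l : ℕ) * ε ^ (2 * (l : ℕ)) / ((l : ℕ).factorial : ℝ))) := by
    ext k l
    simp only [gaussianCollocation, gaussianBasis, Matrix.of_apply, Matrix.mul_diagonal,
      Matrix.diagonal_mul, Matrix.vandermonde_apply]
    ring
  rw [this, Matrix.det_mul, Matrix.det_mul, Matrix.det_diagonal, Matrix.det_diagonal]
  refine mul_ne_zero (mul_ne_zero ?_ (Matrix.det_vandermonde_ne_zero_iff.2 hq)) ?_
  · exact Finset.prod_ne_zero_iff.2 fun k _ => (Real.exp_pos _).ne'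
  · exact Finset.prod_ne_zero_iff.2 fun l _ => (Real.sqrt_pos.2 (by positivity)).ne'

/-- At approximate Fekete points, the Lagrange weights of the first `n` basis functions are bounded
by one. -/
theorem IsApproxFekete.exists_lagrange_weights {ε : ℝ} (hε : 0 < ε) {S : Set ℝ} {n : ℕ}
    {p : Fin n → ℝ} (hp : IsApproxFekete ε S p) {x : ℝ} (hx : x ∈ S) :
    ∃ w : Fin n → ℝ, (∀ j, |w j| ≤ 1) ∧
      ∀ l < n, ∑ j, w j * gaussianBasis ε l (p j) = gaussianBasis ε l x := by
  obtain ⟨⟨hinj, hmem⟩, hmax⟩ := hp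
  set V := gaussianCollocation ε p with hV
  have hdet : V.det ≠ 0 := det_gaussianCollocation_ne_zero hε hinj
  set b : Fin n → ℝ := fun l => gaussianBasis ε l x with hb
  have hup : ∀ j, V.updateRow j b = gaussianCollocation ε (Function.update p j x) := by
    intro j
    ext k l
    by_cases h : k = j
    · subst h; simp [gaussianCollocation, hb]
    · simp [hV, gaussianCollocation, h, Matrix.updateRow_ne]
  -- Cramer's rule: each weight is a quotient of collocation determinants, the numerator having `p
  -- j` replaced by `x`.
  refine ⟨fun j => V.det⁻¹ * V.transpose.cramer b j, fun j => ?_, fun l hl => ?_⟩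
  · beta_reduce
    rw [Matrix.cramer_transpose_apply, hup, abs_mul, abs_inv, inv_mul_le_one₀ (abs_pos.2 hdet)]
    -- Maximality compares only distinct points; a repeated point makes the numerator zero.
    by_cases hi : (Function.update p j x).Injective
    · have h := isMaxOn_iff.1 hmax (Function.update p j x) ⟨hi, fun k => by
        by_cases h : k = j
        · subst h; simpa using hx
        · simpa [h] using hmem k⟩
      simp only [det_truncatedKernel] at h
      exact sq_le_sq.1 h
    · obtain ⟨k, m, hkm, hne⟩ := Function.not_injective_iff.1 hi
      rw [Matrix.det_zero_of_row_eq hne (by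
        ext l
        simp only [gaussianCollocation, Matrix.of_apply, hkm])]
      simp
  · have h := congrFun (Matrix.mulVec_cramer V.transpose b) ⟨l, hl⟩
    simp only [Matrix.mulVec, dotProduct, Matrix.transpose_apply, Matrix.det_transpose,
      Pi.smul_apply, smul_eq_mul, hV, gaussianCollocation, Matrix.of_apply, hb] at h
    rw [← hb, ← gaussianCollocation, ← hV] at h
    simp only [mul_assoc, ← Finset.mul_sum]
    rw [inv_mul_eq_iff_eq_mul₀ hdet, ← h]
    exact Finset.sum_congr rfl fun j _ => mul_comm _ _

/-! ### One-dimensional power function -/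

/-- Best approximation in the span of a finite family. -/
theorem exists_weights_norm_sub_le {E : Type*} [NormedAddCommGroup E] [InnerProductSpace ℝ E]
    {ι : Type*} [Fintype ι] (u : E) (v : ι → E) :
    ∃ w : ι → ℝ, inner ℝ u (∑ j, w j • v j) = ‖∑ j, w j • v j‖ ^ 2 ∧
      ∀ w' : ι → ℝ, ‖u - ∑ j, w j • v j‖ ≤ ‖u - ∑ j, w' j • v j‖ := by
  set U := Submodule.span ℝ (Set.range v) with hU
  have : FiniteDimensional ℝ U := FiniteDimensional.span_of_finite ℝ (Set.finite_range v)
  obtain ⟨w, hw⟩ := (Submodule.mem_span_range_iff_exists_fun ℝ).1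
    (U.starProjection_apply_mem u)
  refine ⟨w, ?_, fun w' => ?_⟩
  · rw [hw, ← real_inner_self_eq_norm_sq]
    have h := U.starProjection_inner_eq_zero u _ (U.starProjection_apply_mem u)
    rw [inner_sub_left] at h
    linarith
  · rw [hw, U.starProjection_minimal]
    exact ciInf_le (f := fun y : U => ‖u - y‖) ⟨0, by rintro _ ⟨y, rfl⟩; exact norm_nonneg _⟩
      ⟨∑ j, w' j • v j, (Submodule.mem_span_range_iff_exists_fun ℝ).2 ⟨w', rfl⟩⟩

/-- One-dimensional interpolation at approximate Fekete points: `δ` is the squared power function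
and `w` are the weights of the best approximation of the kernel translate. -/
theorem IsApproxFekete.exists_projection_weights {ε : ℝ} (hε : 0 < ε) {S : Set ℝ} {n : ℕ}
    {p : Fin n → ℝ} (hp : IsApproxFekete ε S p) {c : ℝ} (hc : ∀ y ∈ S, |y| ≤ c) {x : ℝ}
    (hx : x ∈ S) :
    ∃ (w : Fin n → ℝ) (δ : ℝ), 0 ≤ δ ∧ δ ≤ 1 ∧
      δ ≤ (1 + n) ^ 2 * ((2 * ε ^ 2 * c ^ 2) ^ n / (n.factorial : ℝ)) ∧
      ∑ j, w j * Real.exp (-(ε ^ 2 * (x - p j) ^ 2)) = 1 - δ ∧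
      ∑ j, ∑ k, w j * (w k * Real.exp (-(ε ^ 2 * (p j - p k) ^ 2))) = 1 - δ := by
  obtain ⟨w', hw'1, hw'⟩ := hp.exists_lagrange_weights hε hx
  obtain ⟨w, hw, hmin⟩ := exists_weights_norm_sub_le (gaussianTail ε 0 x)
    (fun j => gaussianTail ε 0 (p j))
  set u := gaussianTail ε 0 x with hu
  set g := ∑ j, w j • gaussianTail ε 0 (p j) with hg
  have hu1 : ‖u‖ ^ 2 = 1 := by
    rw [← real_inner_self_eq_norm_sq, hu, inner_gaussianTail_zero]; simp
  have hsub : ‖u - g‖ ^ 2 = 1 - ‖g‖ ^ 2 := by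
    rw [norm_sub_sq_real, hw, hu1]; ring
  set M := (2 * ε ^ 2 * c ^ 2) ^ n / (n.factorial : ℝ) with hM
  have hM0 : 0 ≤ M := by positivity
  have htail : ∀ y ∈ S, ‖gaussianTail ε n y‖ ≤ Real.sqrt M := by
    intro y hy
    refine Real.le_sqrt_of_sq_le ((norm_gaussianTail_sq_le ε n y).trans ?_)
    have : y ^ 2 ≤ c ^ 2 := by
      rw [← sq_abs y]; exact pow_le_pow_left₀ (abs_nonneg _) (hc y hy) 2
    rw [hM]
    gcongr
  have hcoe : ∀ m l, (∑ j, w' j • gaussianTail ε m (p j)) l =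
      ∑ j, w' j * gaussianTail ε m (p j) l := by
    intro m l
    rw [lp.coeFn_sum, Finset.sum_apply]
    rfl
  -- The Lagrange weights cancel the first `n` coordinates exactly.
  have hdiff : u - ∑ j, w' j • gaussianTail ε 0 (p j) =
      gaussianTail ε n x - ∑ j, w' j • gaussianTail ε n (p j) := by
    ext l
    rw [lp.coeFn_sub, lp.coeFn_sub, Pi.sub_apply, Pi.sub_apply, hcoe, hcoe]
    by_cases hl : n ≤ l
    · simp [hu, hl]
    · simp [hu, hl, hw' l (not_le.1 hl)]
  have hle : ‖u - g‖ ≤ (1 + n) * Real.sqrt M := by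
    refine (hmin w').trans ?_
    rw [hdiff]
    refine (norm_sub_le _ _).trans ?_
    rw [add_mul, one_mul]
    refine add_le_add (htail x hx) ((norm_sum_le _ _).trans ?_)
    have : ∀ j ∈ Finset.univ, ‖w' j • gaussianTail ε n (p j)‖ ≤ Real.sqrt M := by
      intro j _
      rw [norm_smul, Real.norm_eq_abs]
      calc _ ≤ 1 * Real.sqrt M :=
            mul_le_mul (hw'1 j) (htail _ (hp.1.2 j)) (norm_nonneg _) zero_le_one
        _ = _ := one_mul _
    simpa using Finset.sum_le_sum this
  refine ⟨w, ‖u - g‖ ^ 2, by positivity, ?_, ?_, ?_, ?_⟩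
  · rw [hsub]; linarith [sq_nonneg ‖g‖]
  · calc ‖u - g‖ ^ 2 ≤ ((1 + n) * Real.sqrt M) ^ 2 := pow_le_pow_left₀ (norm_nonneg _) hle 2
      _ = _ := by rw [mul_pow, Real.sq_sqrt hM0]
  · rw [hsub, sub_sub_cancel, ← hw, hg, inner_sum]
    refine Finset.sum_congr rfl fun j _ => ?_
    rw [inner_smul_right, hu, inner_gaussianTail_zero]
  · rw [hsub, sub_sub_cancel, ← real_inner_self_eq_norm_sq, hg, sum_inner]
    refine Finset.sum_congr rfl fun j _ => ?_
    rw [inner_sum]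
    refine Finset.sum_congr rfl fun k _ => ?_
    rw [real_inner_smul_left, inner_smul_right, inner_gaussianTail_zero]

/-- Turns the tensor-product distance into a sum of one-dimensional ones. -/
theorem one_sub_sum_le_prod_one_sub {ι : Type*} (s : Finset ι) {δ : ι → ℝ}
    (h0 : ∀ i, 0 ≤ δ i) (h1 : ∀ i, δ i ≤ 1) : 1 - ∑ i ∈ s, δ i ≤ ∏ i ∈ s, (1 - δ i) := by
  classical
  induction s using Finset.induction_on with
  | empty => simp
  | insert i s hi ih =>
    rw [Finset.sum_insert hi, Finset.prod_insert hi]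
    have hp : ∏ j ∈ s, (1 - δ j) ≤ 1 :=
      Finset.prod_le_one (fun j _ => by linarith [h1 j]) fun j _ => by linarith [h0 j]
    nlinarith [h0 i]

theorem inner_eq_zero_of_norm_le_add_smul {E : Type*} [NormedAddCommGroup E]
    [InnerProductSpace ℝ E] {s h : E} (H : ∀ t : ℝ, ‖s‖ ≤ ‖s + t • h‖) : inner ℝ s h = 0 := by
  have hq : ∀ t : ℝ, 0 ≤ ‖h‖ ^ 2 * (t * t) + 2 * inner ℝ s h * t + 0 := by
    intro t
    have h1 := pow_le_pow_left₀ (norm_nonneg _) (H t) 2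
    rw [norm_add_sq_real, norm_smul, inner_smul_right, mul_pow, Real.norm_eq_abs, sq_abs] at h1
    nlinarith
  have := discrim_le_zero hq
  simp only [discrim] at this
  nlinarith [sq_nonneg (inner ℝ s h)]

/-! ### Error of minimum-norm interpolation -/

section
variable {H Ω : Type*} [NormedAddCommGroup H] [InnerProductSpace ℝ H] [CompleteSpace H]
  [RKHS ℝ H Ω ℝ]

theorem kernelInterpolant_apply {X : Set Ω} (f : H) {y : Ω} (hy : y ∈ X) :
    kernelInterpolant X f y = f y :=
  (existsUnique_isMinNormInterpolant X f).choose_spec.1.1 y hy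

/-- Minimality makes the interpolant orthogonal to the error, which vanishes on `X`; then Pythagoras
applies. -/
theorem norm_sub_kernelInterpolant_le (X : Set Ω) (f : H) :
    ‖f - kernelInterpolant X f‖ ≤ ‖f‖ := by
  set s := kernelInterpolant X f with hs
  have hmin : IsMinNormInterpolant X f s :=
    (existsUnique_isMinNormInterpolant X f).choose_spec.1
  have h0 : inner ℝ s (f - s) = 0 := inner_eq_zero_of_norm_le_add_smul fun t => by
    refine hmin.2 _ fun y hy => ?_
    simp [hmin.1 y hy]
  have h1 : ‖f‖ ^ 2 = ‖s‖ ^ 2 + ‖f - s‖ ^ 2 := by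
    have := norm_add_sq_real s (f - s)
    rw [h0, add_sub_cancel] at this
    linarith
  refine (sq_le_sq₀ (norm_nonneg _) (norm_nonneg _)).1 ?_
  nlinarith [sq_nonneg ‖s‖]

/-- The interpolation error at `x` is at most `‖f‖` times the distance of the kernel translate at
`x` from any linear combination of kernel translates at interpolation points. -/
theorem abs_sub_kernelInterpolant_le {X : Set Ω} (f : H) (x : Ω) {ι : Type*} [Fintype ι]
    (y : ι → Ω) (hy : ∀ j, y j ∈ X) (c : ι → ℝ) :
    |f x - kernelInterpolant X f x| ≤
      ‖f‖ * ‖RKHS.kerFun H x (1 : ℝ) - ∑ j, c j • RKHS.kerFun H (y j) (1 : ℝ)‖ := by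
  set s := kernelInterpolant X f with hs
  have h : f x - s x =
      inner ℝ (f - s) (RKHS.kerFun H x (1 : ℝ) - ∑ j, c j • RKHS.kerFun H (y j) (1 : ℝ)) := by
    rw [inner_sub_right, inner_sum]
    have : ∀ j ∈ Finset.univ, inner ℝ (f - s) (c j • RKHS.kerFun H (y j) (1 : ℝ)) = 0 := by
      intro j _
      rw [inner_smul_right, RKHS.inner_kerFun]
      simp [hs, kernelInterpolant_apply f (hy j)]
    rw [Finset.sum_eq_zero this, RKHS.inner_kerFun]
    simp
  rw [h]
  exact (abs_real_inner_le_norm _ _).trans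
    (mul_le_mul_of_nonneg_right (norm_sub_kernelInterpolant_le X f) (norm_nonneg _))

end

/-! ### Tensor-product approximation -/

theorem inner_kerFun_gaussianRKHS {d : ℕ} (ε : Fin d → ℝ) (S : Set (Fin d → ℝ)) (x y : S) :
    inner ℝ (RKHS.kerFun (GaussianRKHS ε S) x (1 : ℝ)) (RKHS.kerFun (GaussianRKHS ε S) y (1 : ℝ)) =
      ∏ i, Real.exp (-(ε i ^ 2 * (x.1 i - y.1 i) ^ 2)) := by
  rw [← RKHS.kernel_inner, RKHS.OfKernel.kernel_ofKernel, ← Real.exp_sum, Finset.sum_neg_distrib]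
  have : gaussianKernel ε y.1 x.1 = gaussianKernel ε x.1 y.1 := by
    simp only [gaussianKernel]
    congr 2
    exact Finset.sum_congr rfl fun i _ => by ring
  simp [gaussianMatrix, this]
  rfl

/-- Distance of a kernel translate from a tensor-product linear combination of kernel translates. -/
theorem norm_kerFun_sub_tensor_sq {d : ℕ} (ε : Fin d → ℝ) (S : Set (Fin d → ℝ)) {n : Fin d → ℕ}
    (p : ∀ i, Fin (n i) → ℝ) (hp : ∀ J : ∀ i, Fin (n i), (fun i => p i (J i)) ∈ S) (x : S)
    (w : ∀ i, Fin (n i) → ℝ) (δ : Fin d → ℝ)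
    (h1 : ∀ i, ∑ j, w i j * Real.exp (-(ε i ^ 2 * (x.1 i - p i j) ^ 2)) = 1 - δ i)
    (h2 : ∀ i, ∑ j, ∑ k, w i j * (w i k * Real.exp (-(ε i ^ 2 * (p i j - p i k) ^ 2))) =
      1 - δ i) :
    ‖RKHS.kerFun (GaussianRKHS ε S) x (1 : ℝ) - ∑ J : ∀ i, Fin (n i), (∏ i, w i (J i)) •
      RKHS.kerFun (GaussianRKHS ε S) (⟨fun i => p i (J i), hp J⟩ : S) (1 : ℝ)‖ ^ 2 =
      1 - ∏ i, (1 - δ i) := by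
  have hsum : ∀ z : S, inner ℝ (RKHS.kerFun (GaussianRKHS ε S) z (1 : ℝ))
      (∑ J : ∀ i, Fin (n i), (∏ i, w i (J i)) •
        RKHS.kerFun (GaussianRKHS ε S) (⟨fun i => p i (J i), hp J⟩ : S) (1 : ℝ)) =
      ∏ i, ∑ j, w i j * Real.exp (-(ε i ^ 2 * (z.1 i - p i j) ^ 2)) := by
    intro z
    rw [inner_sum, Fintype.prod_sum]
    refine Finset.sum_congr rfl fun J _ => ?_
    rw [inner_smul_right, inner_kerFun_gaussianRKHS, Finset.prod_mul_distrib]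
  rw [norm_sub_sq_real, hsum, ← real_inner_self_eq_norm_sq, inner_kerFun_gaussianRKHS,
    ← real_inner_self_eq_norm_sq, sum_inner]
  have hgg : ∑ J : ∀ i, Fin (n i), inner ℝ ((∏ i, w i (J i)) •
        RKHS.kerFun (GaussianRKHS ε S) (⟨fun i => p i (J i), hp J⟩ : S) (1 : ℝ))
      (∑ J : ∀ i, Fin (n i), (∏ i, w i (J i)) •
        RKHS.kerFun (GaussianRKHS ε S) (⟨fun i => p i (J i), hp J⟩ : S) (1 : ℝ)) =
      ∏ i, (1 - δ i) := by
    simp only [← h2, ← Finset.mul_sum]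
    rw [Fintype.prod_sum]
    refine Finset.sum_congr rfl fun J _ => ?_
    rw [real_inner_smul_left, hsum, Finset.prod_mul_distrib]
  rw [hgg]
  simp only [h1, sub_self]
  simp
  ring

/-! ### Explicit constants and conclusion -/

theorem abs_le_absSup_Icc {a b t : ℝ} (ht : t ∈ Set.Icc a b) : |t| ≤ absSup (Set.Icc a b) :=
  le_csSup (isCompact_Icc.image continuous_abs).bddAbove (Set.mem_image_of_mem _ ht)

theorem absSup_Icc_pos {a b : ℝ} (hab : a < b) : 0 < absSup (Set.Icc a b) := by
  rcases eq_or_ne a 0 with h | h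
  · have hb : 0 < |b| := abs_pos.2 (by linarith)
    exact hb.trans_le (abs_le_absSup_Icc ⟨hab.le, le_rfl⟩)
  · exact (abs_pos.2 h).trans_le (abs_le_absSup_Icc ⟨le_rfl, hab.le⟩)

theorem exp_neg_mul_log_sub_log {n : ℕ} (hn : n ≠ 0) {C : ℝ} (hC : 0 < C) :
    Real.exp (-(n : ℝ) * (1 / 2 * Real.log n - Real.log C)) ^ 4 = (C ^ 4 / n ^ 2) ^ n := by
  have hn' : (0 : ℝ) < n := by positivity
  rw [← Real.exp_nat_mul, ← Real.exp_log (show (0 : ℝ) < C ^ 4 / n ^ 2 by positivity),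
    ← Real.exp_nat_mul, Real.log_div (by positivity) (by positivity), Real.log_pow, Real.log_pow]
  congr 1
  push_cast
  ring

/-- The Stirling estimate turning the one-dimensional bound into its explicit form. -/
theorem stirling_error_bound {n : ℕ} (hn : n ≠ 0) {ε c : ℝ} (hε : 0 < ε) (hc : 0 < c) :
    (1 + (n : ℝ)) ^ 2 * ((2 * ε ^ 2 * c ^ 2) ^ n / (n.factorial : ℝ)) ≤
      ((128 / Real.pi) ^ (1 / 4 : ℝ) * ((n : ℝ) ^ (3 / 4 : ℝ) *
        Real.exp (-(n : ℝ) * (1 / 2 * Real.log n -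
          Real.log (Real.sqrt (2 * Real.exp 1) * ε * c))))) ^ 2 := by
  have hn1 : (1 : ℝ) ≤ n := by exact_mod_cast Nat.one_le_iff_ne_zero.2 hn
  have hn' : (0 : ℝ) < n := by linarith
  have hC : 0 < Real.sqrt (2 * Real.exp 1) * ε * c := by positivity
  set r := 2 * ε ^ 2 * c ^ 2 with hr
  have hr0 : 0 < r := by positivity
  have hC4 : (Real.sqrt (2 * Real.exp 1) * ε * c) ^ 4 = (Real.exp 1 * r) ^ 2 := by
    rw [mul_pow, mul_pow, show Real.sqrt (2 * Real.exp 1) ^ 4 =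
      (Real.sqrt (2 * Real.exp 1) ^ 2) ^ 2 by ring, Real.sq_sqrt (by positivity), hr]
    ring
  have hfac := Stirling.le_factorial_stirling n
  set P := Real.sqrt (2 * Real.pi * n) * (n / Real.exp 1) ^ n with hP
  have hP0 : 0 < P := by positivity
  have hpi := Real.pi_pos
  have hP2 : P ^ 2 = 2 * Real.pi * n * ((n / Real.exp 1) ^ n) ^ 2 := by
    rw [hP, mul_pow, Real.sq_sqrt (by positivity)]
  -- Squaring once more clears the fourth roots and the square root in Stirling's bound.
  refine (sq_le_sq₀ (by positivity) (by positivity)).1 ?_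
  rw [← pow_mul, mul_pow _ _ (2 * 2), mul_pow _ _ (2 * 2)]
  norm_num only
  rw [exp_neg_mul_log_sub_log hn hC, hC4]
  have e1 : ((128 / Real.pi) ^ (1 / 4 : ℝ)) ^ 4 = 128 / Real.pi := by
    rw [← Real.rpow_natCast, ← Real.rpow_mul (by positivity)]; norm_num
  have e2 : ((n : ℝ) ^ (3 / 4 : ℝ)) ^ 4 = (n : ℝ) ^ 3 := by
    rw [← Real.rpow_natCast, ← Real.rpow_mul (by positivity), ← Real.rpow_natCast]; norm_num
  rw [e1, e2]
  -- With `1 + n ≤ 2 * n` the constant obtained is `8 / π`; the stated `128 / π` leaves a factor 16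
  -- to spare.
  calc ((1 + (n : ℝ)) ^ 2 * (r ^ n / (n.factorial : ℝ))) ^ 2
      ≤ ((2 * n) ^ 2 * (r ^ n / P)) ^ 2 := by
        gcongr
        linarith
    _ = 16 * n ^ 4 * (r ^ n) ^ 2 / P ^ 2 := by ring
    _ = 128 / Real.pi * (n ^ 3 * ((Real.exp 1 * r) ^ 2 / n ^ 2) ^ n) / 16 := by
        rw [hP2, div_pow _ _ n, div_pow _ _ n, ← pow_mul, ← pow_mul, mul_pow, mul_pow]
        have : Real.exp 1 ≠ 0 := (Real.exp_pos 1).ne'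
        field_simp
        ring
    _ ≤ _ := by
        have : 0 ≤ 128 / Real.pi * (n ^ 3 * ((Real.exp 1 * r) ^ 2 / n ^ 2) ^ n) := by positivity
        linarith

theorem theorem5 {d : ℕ} (ε a b : Fin d → ℝ) (n : Fin d → ℕ) (p : ∀ i, Fin (n i) → ℝ)
    (hε : ∀ i, 0 < ε i) (hab : ∀ i, a i < b i)
    (hp : ∀ i, IsApproxFekete (ε i) (Set.Icc (a i) (b i)) (p i))
    (hn : ∀ i, 2 * ε i ^ 2 * absSup (Set.Icc (a i) (b i)) ^ 2 ≤ (n i : ℝ))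
    (f : GaussianRKHS ε (hyperRectangle a b)) (x : hyperRectangle a b) :
    |f x - kernelInterpolant (tensorPoints (hyperRectangle a b) p) f x| ≤
      (128 / Real.pi) ^ (1 / 4 : ℝ) * ‖f‖ *
        ∑ i, (n i : ℝ) ^ (3 / 4 : ℝ) *
          Real.exp (-(n i : ℝ) * (1 / 2 * Real.log (n i) -
            Real.log (Real.sqrt (2 * Real.exp 1) * ε i * absSup (Set.Icc (a i) (b i))))) := by
  have hc : ∀ i, 0 < absSup (Set.Icc (a i) (b i)) := fun i => absSup_Icc_pos (hab i)
  have hn0 : ∀ i, n i ≠ 0 := by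
    intro i h
    have h1 := hn i
    have h2 : 0 < 2 * ε i ^ 2 * absSup (Set.Icc (a i) (b i)) ^ 2 := by
      have := hε i; have := hc i; positivity
    rw [h, Nat.cast_zero] at h1
    linarith
  have hx : ∀ i, x.1 i ∈ Set.Icc (a i) (b i) := fun i => x.2 i (Set.mem_univ i)
  choose w δ hδ0 hδ1 hδ h1 h2 using fun i =>
    (hp i).exists_projection_weights (hε i) (fun y hy => abs_le_absSup_Icc hy) (hx i)
  have hmem : ∀ J : ∀ i, Fin (n i), (fun i => p i (J i)) ∈ hyperRectangle a b :=
    fun J i _ => (hp i).1.2 (J i)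
  refine (abs_sub_kernelInterpolant_le f x (fun J => ⟨fun i => p i (J i), hmem J⟩)
    (fun J i _ => ⟨J i, rfl⟩) (fun J => ∏ i, w i (J i))).trans ?_
  rw [mul_comm (_ ^ _) ‖f‖, mul_assoc, Finset.mul_sum]
  refine mul_le_mul_of_nonneg_left ?_ (norm_nonneg _)
  have hβ : ∀ i ∈ Finset.univ, 0 ≤ (128 / Real.pi) ^ (1 / 4 : ℝ) * ((n i : ℝ) ^ (3 / 4 : ℝ) *
      Real.exp (-(n i : ℝ) * (1 / 2 * Real.log (n i) -
        Real.log (Real.sqrt (2 * Real.exp 1) * ε i * absSup (Set.Icc (a i) (b i)))))) := by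
    intro i _; positivity
  refine (sq_le_sq₀ (norm_nonneg _) (Finset.sum_nonneg hβ)).1 ?_
  rw [norm_kerFun_sub_tensor_sq ε _ p hmem x w δ h1 h2]
  calc 1 - ∏ i, (1 - δ i) ≤ ∑ i, δ i := by
        linarith [one_sub_sum_le_prod_one_sub Finset.univ hδ0 hδ1]
    _ ≤ _ := Finset.sum_le_sum fun i _ =>
        (hδ i).trans (stirling_error_bound (hn0 i) (hε i) (hc i))
    -- For nonnegative terms the sum of squares is at most the square of the sum, so no
    -- dimension-dependent constant appears.
    _ ≤ _ := Finset.sum_sq_le_sq_sum_of_nonneg hβ
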